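/- All graphs are finite and simple. Let $G$ be a connected graph on at least two vertices with a (not necessarily proper) vertex-coloring. A set of vertices is \emph{rainbow} if no two of its vertices have the same color. For two distinct vertices $x,y$ of $G$, an $x$-$y$ \emph{rainbow vertex-cut} is a set $S\subseteq V(G)\setminus\{x,y\}$ such that: if $x,y$ are nonadjacent, then $x$ and $y$ lie in different components of $G-S$ and $S$ is rainbow; if $x,y$ are adjacent, then $x$ and $y$ lie in different components of $(G-xy)-S$ and $S\cup\{x\}$ or $S\cup\{y\}$ is rainbow. The \emph{rainbow vertex-disconnection number} $rvd(G)$ is the minimum number of colors in a vertex-coloring of $G$ for which every two distinct vertices $x,y$ have an $x$-$y$ rainbow vertex-cut. \textbf{Theorem.} Let $n\ge 4$ and $1\le k\le n$ be integers. Then there is a connected graph $G$ of order $n$ with $rvd(G)=k$, and the minimum number of edges of such a graph is $$|E(G)|_{\min}=\begin{cases} n+k-2, & 1\le k\le n-1,\\ 2n-4+\left\lceil \frac n2\right\rceil, & k=n.\end{cases}$$ -/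

import Mathlib

namespace RainbowVertexDisconnection

variable {V : Type*} {C : Type*}

/-- `x` and `y` are vertices of `H - S` and lie in different components of `H - S`. -/
def SeparatedBy (H : SimpleGraph V) (x y : V) (S : Set V) : Prop :=
  ∃ (hx : x ∈ Sᶜ) (hy : y ∈ Sᶜ), ¬ (H.induce Sᶜ).Reachable ⟨x, hx⟩ ⟨y, hy⟩

/-- An `x`-`y` vertex-cut: if `x` and `y` are nonadjacent, then `S` separates them in `G`;
if they are adjacent, then `S` separates them in `G - xy`. -/
def IsVertexCut (G : SimpleGraph V) (x y : V) (S : Set V) : Prop :=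
  (¬ G.Adj x y → SeparatedBy G x y S) ∧
    (G.Adj x y → SeparatedBy (G.deleteEdges {s(x, y)}) x y S)

/-- A set of vertices is rainbow if no two of its vertices have the same color. -/
def IsRainbow (c : V → C) (S : Set V) : Prop :=
  ∀ u ∈ S, ∀ v ∈ S, u ≠ v → c u ≠ c v

/-- An `x`-`y` rainbow vertex-cut: a vertex-cut `S` that is rainbow if `x` and `y` are
nonadjacent, and such that `S + x` or `S + y` is rainbow if they are adjacent. -/
def IsRainbowVertexCut (G : SimpleGraph V) (c : V → C) (x y : V) (S : Set V) : Prop :=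
  IsVertexCut G x y S ∧
    (¬ G.Adj x y → IsRainbow c S) ∧
    (G.Adj x y → IsRainbow c (insert x S) ∨ IsRainbow c (insert y S))

/-- `c` is a rainbow vertex-disconnection coloring of `G`: any two distinct vertices have a
rainbow vertex-cut. (The coloring need not be proper.) -/
def IsRVDColoring (G : SimpleGraph V) (c : V → C) : Prop :=
  ∀ x y : V, x ≠ y → ∃ S : Set V, IsRainbowVertexCut G c x y S

/-- The rainbow vertex-disconnection number: the least number of colors in a rainbow
vertex-disconnection coloring. -/
noncomputable def rvd (G : SimpleGraph V) : ℕ :=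
  sInf {k : ℕ | ∃ c : V → Fin k, IsRVDColoring G c}

/-- Coloring all vertices differently is a rainbow vertex-disconnection coloring. -/
theorem isRVDColoring_of_injective (G : SimpleGraph V) (c : V → C)
    (hc : Function.Injective c) : IsRVDColoring G c := by
  have rb : ∀ S : Set V, IsRainbow c S := fun S u _ v _ huv h => huv (hc h)
  have key : ∀ (H : SimpleGraph V) (x y : V), x ≠ y → ¬ H.Adj x y →
      SeparatedBy H x y ({x, y}ᶜ) := by
    intro H x y hxy hH
    refine ⟨by simp, by simp, ?_⟩
    rintro ⟨p⟩
    cases p with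
    | nil => exact hxy rfl
    | @cons _ w _ h q =>
      obtain ⟨w, hw⟩ := w
      have h' : H.Adj x w := h
      have hw' : w = x ∨ w = y := by simpa using hw
      rcases hw' with rfl | rfl
      · exact H.loopless.irrefl _ h'
      · exact hH h'
  intro x y hxy
  refine ⟨{x, y}ᶜ, ⟨fun h => key G x y hxy h, fun _ => key _ x y hxy (by simp)⟩,
    fun _ => rb _, fun _ => Or.inl (rb _)⟩

/-- For a finite graph the minimum in the definition of `rvd` is over a nonempty set, so it is
attained. -/
theorem exists_isRVDColoring_rvd [Finite V] (G : SimpleGraph V) :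
    ∃ c : V → Fin (rvd G), IsRVDColoring G c := by
  obtain ⟨n, ⟨e⟩⟩ := Finite.exists_equiv_fin V
  exact Nat.sInf_mem (s := {k : ℕ | ∃ c : V → Fin k, IsRVDColoring G c})
    ⟨n, e, isRVDColoring_of_injective G e e.injective⟩

end RainbowVertexDisconnection

/-! For `k ≤ n - 1` the lower bound is `rvd G ≤ |E| - n + 2`, one more than the cyclomatic number
(`rvd_le`). It comes from `exists_coloringOn_ne`, an induction on the order which for `k ≥ 2` colors
also lets two prescribed vertices `p`, `q` receive different colors. This stronger claim feeds
itself: deleting a vertex `p` of degree `d` lowers the cyclomatic number by `d - 1` if the rest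
stays connected. Since two neighbors of `p` may be assumed to differ already, `d - 2` new colors
make its neighborhood rainbow and one more serves `p` itself. Leaves are free, and at a cut vertex
the two sides are colored separately. If the rest is a tree, no color may be wasted, and `p` shares
its color with a leaf of that tree. Equality holds for a star in which one further vertex is joined
to `k - 1` others: the ends of the edge joining it to the center have `k - 1` common neighbors,
which every cut contains.

For `k = n`, any two vertices must have two common neighbors, as otherwise they can share a color
(`rvd_lt_card`); conversely this property forces all colors to differ (`card_le_rvd`). Counting
degrees around a vertex of minimum degree gives `2|E| ≥ 5n - 8` (`le_ncard_edgeSet`), and two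
adjacent hubs joined to everything, with the other vertices nearly perfectly matched, attain the
bound. -/

namespace RainbowVertexDisconnection

/-! ### Cuts and colorings of induced subgraphs, and removal of leaves. -/

section Relative

open Classical Finset

variable {V : Type*} {C : Type*}

/-- `S` separates `x` from `y` in the subgraph of `G` induced by `W`, where an edge `xy` is ignored;
`A` witnesses the side of `x`. -/
def CutOn (G : SimpleGraph V) (W : Finset V) (x y : V) (S : Finset V) : Prop :=
  S ⊆ W ∧ x ∉ S ∧ y ∉ S ∧ ∃ A : Set V, x ∈ A ∧ y ∉ A ∧
    ∀ a ∈ W, ∀ b ∈ W, a ∈ A → b ∉ A → G.Adj a b → a ∈ S ∨ b ∈ S ∨ (a = x ∧ b = y)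

/-- `x` and `y` have a rainbow vertex-cut in the subgraph of `G` induced by `W`. -/
def RainbowCutOn (G : SimpleGraph V) (W : Finset V) (c : V → C) (x y : V) : Prop :=
  ∃ S : Finset V, CutOn G W x y S ∧ Set.InjOn c S ∧
    (G.Adj x y → Set.InjOn c (insert x S : Finset V) ∨ Set.InjOn c (insert y S : Finset V))

/-- `c` is a rainbow vertex-disconnection coloring of the subgraph of `G` induced by `W`. -/
def ColoringOn (G : SimpleGraph V) (W : Finset V) (c : V → C) : Prop :=
  ∀ x ∈ W, ∀ y ∈ W, x ≠ y → RainbowCutOn G W c x y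

/-- The subgraph of `G` induced by `W` is connected: no proper nonempty part is isolated. -/
def ConnOn (G : SimpleGraph V) (W : Finset V) : Prop :=
  ∀ A ⊆ W, A.Nonempty → A ≠ W → ∃ a ∈ A, ∃ b ∈ W, b ∉ A ∧ G.Adj a b

/-- The neighbors of `v` in `W`. -/
noncomputable def nbrOn (G : SimpleGraph V) (W : Finset V) (v : V) : Finset V :=
  W.filter (G.Adj v)

/-- The sum of the degrees of the subgraph of `G` induced by `W`. -/
noncomputable def degSum (G : SimpleGraph V) (W : Finset V) : ℕ :=
  ∑ v ∈ W, (nbrOn G W v).card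

variable {G : SimpleGraph V} {W : Finset V} {x y p q : V}

@[simp] theorem mem_nbrOn {v u : V} : u ∈ nbrOn G W v ↔ u ∈ W ∧ G.Adj v u := by
  simp [nbrOn]

theorem CutOn.symm {S : Finset V} (h : CutOn G W x y S) : CutOn G W y x S := by
  obtain ⟨hS, hx, hy, A, hxA, hyA, hA⟩ := h
  refine ⟨hS, hy, hx, Aᶜ, hyA, by simpa using hxA, ?_⟩
  intro a ha b hb haA hbA hab
  have := hA b hb a ha (by simpa using hbA) haA hab.symm
  tauto

theorem RainbowCutOn.symm {c : V → C} (h : RainbowCutOn G W c x y) : RainbowCutOn G W c y x := by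
  obtain ⟨S, hS, hc, hr⟩ := h
  exact ⟨S, hS.symm, hc, fun h => (hr h.symm).symm⟩

/-- Refining a coloring keeps rainbow cuts. -/
theorem RainbowCutOn.refine {D : Type*} {c : V → C} {c' : V → D} (hx : x ∈ W) (hy : y ∈ W)
    (hc : ∀ u ∈ W, ∀ v ∈ W, c' u = c' v → c u = c v) (h : RainbowCutOn G W c x y) :
    RainbowCutOn G W c' x y := by
  obtain ⟨S, hS, hi, hr⟩ := h
  have key : ∀ T : Finset V, T ⊆ W → Set.InjOn c T → Set.InjOn c' T := fun T hT hi u hu v hv e =>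
    hi hu hv (hc u (hT hu) v (hT hv) e)
  exact ⟨S, hS, key S hS.1 hi, fun h => (hr h).imp
    (key _ (insert_subset hx hS.1)) (key _ (insert_subset hy hS.1))⟩

/-- The neighborhood of a vertex, without the other vertex, is a cut. -/
theorem cutOn_nbrOn (hxy : x ≠ y) : CutOn G W x y ((nbrOn G W x).erase y) := by
  refine ⟨fun a ha => (mem_nbrOn.1 (mem_of_mem_erase ha)).1, by simp, by simp, {x}, rfl,
    by simpa using hxy.symm, ?_⟩
  rintro a - b hb rfl - hab
  by_cases hby : b = y
  · exact Or.inr (Or.inr ⟨rfl, hby⟩)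
  · exact Or.inr (Or.inl (by simp [hby, hb, hab]))

theorem card_nbrOn_pos (hW : ConnOn G W) {v w : V} (hv : v ∈ W) (hw : w ∈ W) (hvw : v ≠ w) :
    0 < (nbrOn G W v).card := by
  obtain ⟨a, ha, b, hb, -, hab⟩ := hW {v} (by simpa using hv) (by simp)
    (fun h => hvw (mem_singleton.1 (h ▸ hw)).symm)
  rw [mem_singleton] at ha
  subst ha
  exact card_pos.2 ⟨b, by simp [hb, hab]⟩

theorem nbrOn_erase (v : V) : nbrOn G (W.erase p) v = (nbrOn G W v).erase p := by
  ext u; simp; tauto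

/-- Deleting `p` loses its own degree and one unit at each of its neighbors. -/
theorem degSum_erase (hp : p ∈ W) :
    degSum G W = degSum G (W.erase p) + 2 * (nbrOn G W p).card := by
  have h1 : degSum G (W.erase p) + (nbrOn G W p).card =
      ∑ v ∈ W.erase p, (nbrOn G W v).card := by
    have : (nbrOn G W p).card = ∑ v ∈ W.erase p, if G.Adj v p then 1 else 0 := by
      rw [← card_filter]
      congr 1
      ext u
      simp only [mem_nbrOn, mem_filter, mem_erase, G.adj_comm u p]
      exact ⟨fun h => ⟨⟨h.2.ne', h.1⟩, h.2⟩, fun h => ⟨h.1.2, h.2⟩⟩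
    rw [this, degSum, ← sum_add_distrib]
    refine sum_congr rfl fun v hv => ?_
    rw [nbrOn_erase]
    split_ifs with h
    · exact card_erase_add_one (by simp [hp, h])
    · rw [erase_eq_of_notMem (by simp [h]), add_zero]
  rw [degSum, ← add_sum_erase _ _ hp, ← h1]
  ring

/-- Erasing a vertex of degree one keeps connectedness. -/
theorem ConnOn.erase_leaf (hW : ConnOn G W) {w : V} (hw : w ∈ W)
    (hd : (nbrOn G W w).card = 1) : ConnOn G (W.erase w) := by
  obtain ⟨u, hu⟩ := card_eq_one.1 hd
  have hu1 : ∀ b ∈ W, G.Adj w b → b = u := fun b hb h => by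
    have : b ∈ nbrOn G W w := by simp [hb, h]
    simpa [hu] using this
  have huW : u ∈ W ∧ G.Adj w u := by rw [← mem_nbrOn, hu]; simp
  intro A hA hne hAW
  have hwA : w ∉ A := fun h => by simpa using hA h
  by_cases huA : u ∈ A
  -- The leaf joins the side of its neighbor `u`, so the crossing edge found in `W` avoids the leaf.
  · obtain ⟨a, ha, b, hb, hbA, hab⟩ := hW (insert w A)
      (insert_subset hw (hA.trans (erase_subset _ _))) (by simp)
      (fun h => hAW (by rw [← h, erase_insert hwA]))
    rw [mem_insert, not_or] at hbA
    rcases mem_insert.1 ha with rfl | ha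
    · exact absurd huA (hu1 b hb hab ▸ hbA.2)
    · exact ⟨a, ha, b, by simp [hbA.1, hb], hbA.2, hab⟩
  · obtain ⟨a, ha, b, hb, hbA, hab⟩ := hW A (hA.trans (erase_subset _ _)) hne
      (fun h => hwA (h ▸ hw))
    refine ⟨a, ha, b, ?_, hbA, hab⟩
    rw [mem_erase]
    refine ⟨?_, hb⟩
    rintro rfl
    exact huA (hu1 a (mem_of_mem_erase (hA ha)) hab.symm ▸ ha)

/-- Adding a vertex of degree one keeps cuts. -/
theorem CutOn.of_erase_leaf {w : V} (hd : (nbrOn G W w).card = 1)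
    {S : Finset V} (hx : x ≠ w) (hy : y ≠ w) (h : CutOn G (W.erase w) x y S) :
    CutOn G W x y S := by
  obtain ⟨u, hu⟩ := card_eq_one.1 hd
  have hu1 : ∀ b ∈ W, G.Adj w b → b = u := fun b hb h => by
    have : b ∈ nbrOn G W w := by simp [hb, h]
    simpa [hu] using this
  obtain ⟨hS, hxS, hyS, A, hxA, hyA, hA⟩ := h
  -- The leaf is placed on the side of its only neighbor, so its edge never crosses.
  refine ⟨hS.trans (erase_subset _ _), hxS, hyS, {a | (a ≠ w ∧ a ∈ A) ∨ (a = w ∧ u ∈ A)},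
    Or.inl ⟨hx, hxA⟩, by simp [hy, hyA], ?_⟩
  intro a ha b hb haA hbA hab
  simp only [Set.mem_ofPred_eq] at haA hbA
  by_cases haw : a = w
  · subst haw
    have := hu1 b hb hab
    subst this
    have := hab.ne'
    tauto
  · by_cases hbw : b = w
    · subst hbw
      have := hu1 a ha hab.symm
      subst this
      tauto
    · exact hA a (by simp [haw, ha]) b (by simp [hbw, hb]) (by tauto) (by tauto) hab

theorem cutOn_leaf {w u v : V} (hu : nbrOn G W w = {u}) (hv : v ≠ u) (hw : v ≠ w) :
    CutOn G W w v {u} := by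
  have := cutOn_nbrOn (G := G) (W := W) hw.symm
  rwa [hu, erase_eq_of_notMem (by simpa using hv)] at this

theorem cutOn_leaf_nbr {w u : V} (hu : nbrOn G W w = {u}) : CutOn G W w u ∅ := by
  have h : u ∈ nbrOn G W w := by simp [hu]
  have := cutOn_nbrOn (G := G) (W := W) (mem_nbrOn.1 h).2.ne
  rwa [hu, erase_singleton] at this

/-- Adding a vertex of degree one keeps colorings. -/
theorem ColoringOn.of_erase_leaf {c : V → C} {w : V} (hd : (nbrOn G W w).card = 1)
    (h : ColoringOn G (W.erase w) c) : ColoringOn G W c := by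
  obtain ⟨u, hu⟩ := card_eq_one.1 hd
  have hadj : G.Adj w u := by
    have h : u ∈ nbrOn G W w := by simp [hu]
    exact (mem_nbrOn.1 h).2
  have key : ∀ v ∈ W, v ≠ w → RainbowCutOn G W c w v := by
    intro v hvW hv
    by_cases hvu : v = u
    · subst hvu
      exact ⟨∅, cutOn_leaf_nbr hu, by simp, fun _ => Or.inl (by simp)⟩
    · refine ⟨{u}, cutOn_leaf hu hvu hv, by simp, fun hwv => ?_⟩
      have : v ∈ nbrOn G W w := by simp [hvW, hwv]
      rw [hu, mem_singleton] at this
      exact absurd this hvu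
  intro x hx y hy hxy
  by_cases hxw : x = w
  · subst hxw; exact key y hy hxy.symm
  by_cases hyw : y = w
  · subst hyw; exact (key x hx hxy).symm
  obtain ⟨S, hS, hr⟩ := h x (by simp [hxw, hx]) y (by simp [hyw, hy]) hxy
  exact ⟨S, hS.of_erase_leaf hd hxw hyw, hr⟩

/-! ### Trees. -/

/-- A finite connected graph that has few edges has a vertex of degree one,
which can be avoided to be a prescribed one. -/
theorem exists_leaf (hW : ConnOn G W) (hq : q ∈ W) (h2 : 2 ≤ W.card)
    (hd : degSum G W + 2 ≤ 2 * W.card) : ∃ w ∈ W, w ≠ q ∧ (nbrOn G W w).card = 1 := by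
  by_contra! hcon
  obtain ⟨r, hr, hrq⟩ := exists_mem_ne (by omega : 1 < W.card) q
  -- Degrees at least 2 away from `q` and at least 1 at `q` would sum to at least `2|W| - 1`.
  have h1 : ∑ v ∈ W.erase q, 2 ≤ ∑ v ∈ W.erase q, (nbrOn G W v).card := by
    refine sum_le_sum fun v hv => ?_
    rw [mem_erase] at hv
    have := card_nbrOn_pos hW hv.2 hq hv.1
    have := hcon v hv.2 hv.1
    omega
  have h3 := card_nbrOn_pos hW hq hr hrq.symm
  rw [degSum, ← add_sum_erase _ _ hq] at hd
  rw [sum_const, smul_eq_mul, card_erase_of_mem hq] at h1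
  omega

/-- A connected graph on `n` vertices has at least `n - 1` edges. -/
theorem le_degSum (hW : ConnOn G W) : 2 * W.card ≤ degSum G W + 2 := by
  induction hn : W.card generalizing W with
  | zero => simp
  | succ n ih =>
    by_contra! hlt
    obtain ⟨q, hq⟩ : W.Nonempty := card_pos.1 (by omega)
    by_cases h2 : 2 ≤ W.card
    · obtain ⟨w, hw, -, hd⟩ := exists_leaf hW hq h2 (by omega)
      have := ih (hW.erase_leaf hw hd) (by rw [card_erase_of_mem hw]; omega)
      have := degSum_erase (G := G) hw
      omega
    · omega

/-- In a tree two vertices are separated by at most one vertex, which is not a leaf. -/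
theorem exists_cutOn_of_tree (hW : ConnOn G W) (hd : degSum G W + 2 ≤ 2 * W.card)
    (hx : x ∈ W) (hy : y ∈ W) (hxy : x ≠ y) :
    ∃ S : Finset V, CutOn G W x y S ∧ S.card ≤ 1 ∧ (G.Adj x y → S = ∅) ∧
      ∀ s ∈ S, 2 ≤ (nbrOn G W s).card := by
  induction hn : W.card generalizing W x y with
  | zero => simp_all
  | succ n ih =>
    have h2 : 2 ≤ W.card := one_lt_card.2 ⟨x, hx, y, hy, hxy⟩
    obtain ⟨w, hw, -, hdw⟩ := exists_leaf hW hx h2 hd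
    have hW' := hW.erase_leaf hw hdw
    have hds := degSum_erase (G := G) hw
    have hcard := card_erase_of_mem hw
    obtain ⟨u, hu⟩ := card_eq_one.1 hdw
    have hwu : u ∈ W ∧ G.Adj w u := by rw [← mem_nbrOn, hu]; simp
    have key : ∀ v ∈ W, v ≠ w → ∃ S : Finset V, CutOn G W w v S ∧ S.card ≤ 1 ∧
        (G.Adj w v → S = ∅) ∧ ∀ s ∈ S, 2 ≤ (nbrOn G W s).card := by
      intro v hvW hv
      by_cases hvu : v = u
      · subst hvu
        exact ⟨∅, cutOn_leaf_nbr hu, by simp, by simp, by simp⟩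
      · refine ⟨{u}, cutOn_leaf hu hvu hv, by simp, fun hwv => ?_, ?_⟩
        · have : v ∈ nbrOn G W w := by simp [hvW, hwv]
          rw [hu, mem_singleton] at this
          exact absurd this hvu
        · simp only [mem_singleton, forall_eq]
          -- The rest stays connected and contains `v ≠ u`, so `u` has a neighbor besides `w`.
          have := card_nbrOn_pos hW' (v := u) (w := v) (by simp [hwu.1, hwu.2.ne'])
            (by simp [hvW, hv]) (Ne.symm hvu)
          rw [nbrOn_erase, card_erase_of_mem (by simp [hw, hwu.2.symm])] at this
          omega
    by_cases hxw : x = w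
    · subst hxw; exact key y hy hxy.symm
    by_cases hyw : y = w
    · subst hyw
      obtain ⟨S, hS, h1, h2, h3⟩ := key x hx hxy
      exact ⟨S, hS.symm, h1, fun h => h2 h.symm, h3⟩
    obtain ⟨S, hS, h1, h2, h3⟩ := ih hW' (by omega) (x := x) (y := y) (by simp [hxw, hx])
      (by simp [hyw, hy]) hxy (by omega)
    refine ⟨S, hS.of_erase_leaf hdw hxw hyw, h1, h2, fun s hs => (h3 s hs).trans ?_⟩
    rw [nbrOn_erase]
    exact card_le_card (erase_subset _ _)

/-- Every coloring of a tree is a rainbow vertex-disconnection coloring. -/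
theorem coloringOn_of_tree (hW : ConnOn G W) (hd : degSum G W + 2 ≤ 2 * W.card) (c : V → C) :
    ColoringOn G W c := by
  intro x hx y hy hxy
  obtain ⟨S, hS, h1, h2, -⟩ := exists_cutOn_of_tree hW hd hx hy hxy
  refine ⟨S, hS, fun a ha b hb _ => card_le_one.1 h1 a ha b hb, fun h => Or.inl ?_⟩
  simp [h2 h]

end Relative

/-! ### Extending a coloring by one vertex. -/

section Bound

open Classical Finset

variable {V : Type*} {G : SimpleGraph V} {W : Finset V} {p q : V}

/-- A finset can be numbered injectively. -/
theorem exists_injOn_lt_card (N : Finset V) :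
    ∃ f : V → ℕ, Set.InjOn f N ∧ ∀ v ∈ N, f v < N.card := by
  refine ⟨fun v => if h : v ∈ N then (N.equivFin ⟨v, h⟩ : ℕ) else 0, ?_, ?_⟩
  · intro a ha b hb hab
    rw [mem_coe] at ha hb
    simp only [ha, hb, dif_pos] at hab
    simpa using N.equivFin.injective (Fin.ext hab)
  · intro v hv
    simp [hv]

/-- Rainbow cuts between a vertex and the others, if its neighborhood is rainbow. -/
theorem rainbowCutOn_of_injOn_nbrOn {C : Type*} {c : V → C} {v : V}
    (hN : Set.InjOn c (nbrOn G W p)) (hv : v ∈ W) (hpv : p ≠ v) : RainbowCutOn G W c p v := by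
  refine ⟨_, cutOn_nbrOn hpv, hN.mono (by simp), fun h => Or.inr ?_⟩
  rwa [insert_erase (by simp [hv, h])]

/-- Putting back a vertex into a cut of the graph without it. -/
theorem CutOn.insert_erased {x y : V} {S : Finset V} (hp : p ∈ W) (hx : x ≠ p) (hy : y ≠ p)
    (h : CutOn G (W.erase p) x y S) : CutOn G W x y (insert p S) := by
  obtain ⟨hS, hxS, hyS, A, hxA, hyA, hA⟩ := h
  refine ⟨insert_subset hp (hS.trans (erase_subset _ _)), by simp [hx, hxS], by simp [hy, hyS],
    A, hxA, hyA, ?_⟩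
  intro a ha b hb haA hbA hab
  by_cases hap : a = p
  · simp [hap]
  by_cases hbp : b = p
  · simp [hbp]
  have := hA a (by simp [hap, ha]) b (by simp [hbp, hb]) haA hbA hab
  simp only [mem_insert]
  tauto

/-- Extending a coloring by a vertex with a rainbow neighborhood and a new color. -/
theorem ColoringOn.of_erase {c c' : V → ℕ} (hp : p ∈ W) (h : ColoringOn G (W.erase p) c)
    (href : ∀ u ∈ W.erase p, ∀ v ∈ W.erase p, c' u = c' v → c u = c v)
    (hnew : ∀ v ∈ W.erase p, c' v ≠ c' p) (hN : Set.InjOn c' (nbrOn G W p)) :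
    ColoringOn G W c' := by
  intro x hx y hy hxy
  by_cases hxp : x = p
  · subst hxp; exact rainbowCutOn_of_injOn_nbrOn hN hy hxy
  by_cases hyp : y = p
  · subst hyp; exact (rainbowCutOn_of_injOn_nbrOn hN hx hxy.symm).symm
  have hx' : x ∈ W.erase p := by simp [hxp, hx]
  have hy' : y ∈ W.erase p := by simp [hyp, hy]
  obtain ⟨S, hS, hi, hr⟩ := (h x hx' y hy' hxy).refine hx' hy' href
  have key : ∀ T : Finset V, T ⊆ W.erase p → Set.InjOn c' T →
      Set.InjOn c' (insert p T : Finset V) := by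
    intro T hT hi
    have hpT : p ∉ (T : Set V) := fun h => by simpa using hT h
    rw [coe_insert, Set.injOn_insert hpT]
    refine ⟨hi, ?_⟩
    rintro ⟨v, hv, hvp⟩
    exact hnew v (hT hv) hvp
  refine ⟨_, hS.insert_erased hp hxp hyp, key S hS.1 hi, fun h => ?_⟩
  rw [insert_comm x, insert_comm y]
  exact (hr h).imp (key _ (insert_subset hx' hS.1)) (key _ (insert_subset hy' hS.1))

/-- If deleting `p` leaves a tree with a leaf `l` adjacent to `p`, it suffices that the
neighborhood of `p` is rainbow and that only `p` and `l` share a color with `p`. -/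
theorem coloringOn_of_erase_tree {C : Type*} {c : V → C} {l : V} (hp : p ∈ W)
    (hW : ConnOn G (W.erase p)) (hd : degSum G (W.erase p) + 2 ≤ 2 * (W.erase p).card)
    (hl : (nbrOn G (W.erase p) l).card = 1)
    (hN : Set.InjOn c (nbrOn G W p)) (hc : ∀ v ∈ W, c v = c p → v = p ∨ v = l) :
    ColoringOn G W c := by
  intro x hx y hy hxy
  by_cases hxp : x = p
  · subst hxp; exact rainbowCutOn_of_injOn_nbrOn hN hy hxy
  by_cases hyp : y = p
  · subst hyp; exact (rainbowCutOn_of_injOn_nbrOn hN hx hxy.symm).symm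
  have hx' : x ∈ W.erase p := by simp [hxp, hx]
  have hy' : y ∈ W.erase p := by simp [hyp, hy]
  obtain ⟨S, hS, h1, h2, h3⟩ := exists_cutOn_of_tree hW hd hx' hy' hxy
  have hpS : p ∉ (S : Set V) := fun h => by simpa using hS.1 h
  refine ⟨_, hS.insert_erased hp hxp hyp, ?_, fun h => ?_⟩
  · rw [coe_insert, Set.injOn_insert hpS]
    refine ⟨fun a ha b hb _ => card_le_one.1 h1 a ha b hb, ?_⟩
    rintro ⟨v, hv, hvp⟩
    -- A clash with `p` could only come from `l`, but tree cuts avoid leaves.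
    rcases hc v (mem_of_mem_erase (hS.1 hv)) hvp with rfl | rfl
    · exact hpS hv
    · have := h3 v hv
      omega
  · have key : ∀ v ∈ W, v ≠ p → c v ≠ c p →
        Set.InjOn c (insert v (insert p S) : Finset V) := by
      intro v _ hvp hcv
      rw [h2 h]
      simp only [insert_empty_eq, coe_insert, coe_singleton]
      rw [Set.injOn_insert (by simpa using hvp)]
      simpa using hcv
    -- For an edge of the tree the cut is `{p}` alone, and at most one end is `l`; the other end has
    -- a color different from that of `p`.
    by_cases hcx : c x = c p
    · refine Or.inr (key y hy hyp fun hcy => hxy ?_)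
      rw [(hc x hx hcx).resolve_left hxp, (hc y hy hcy).resolve_left hyp]
    · exact Or.inl (key x hx hxp hcx)

/-! ### Gluing at a cut vertex. -/

/-- The two parts at a cut vertex are connected. -/
theorem ConnOn.insert_part {A B : Finset V} (hW : ConnOn G W) (hp : p ∈ W)
    (hAB : ∀ v, v ∈ W ↔ v = p ∨ v ∈ A ∨ v ∈ B) (hpA : p ∉ A) (hpB : p ∉ B)
    (hdis : ∀ v ∈ A, v ∉ B) (hno : ∀ a ∈ A, ∀ b ∈ B, ¬ G.Adj a b) : ConnOn G (insert p A) := by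
  intro X hX hne hXA
  by_cases hpX : p ∈ X
  -- Adding all of `B` to the side of `p` forces the crossing edge to end in `A`.
  · obtain ⟨a, ha, b, hb, hbX, hab⟩ := hW (X ∪ B) (by
      intro v hv
      rw [hAB]
      rcases mem_union.1 hv with h | h
      · have := mem_insert.1 (hX h); tauto
      · tauto) (hne.mono subset_union_left) (by
      intro h
      refine hXA (subset_antisymm hX fun v hv => ?_)
      rcases mem_insert.1 hv with rfl | hv
      · exact hpX
      · have : v ∈ X ∪ B := by rw [h, hAB]; tauto
        exact (mem_union.1 this).resolve_right (hdis v hv))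
    rw [mem_union, not_or] at hbX
    rw [hAB] at hb
    have hbA : b ∈ A := by
      rcases hb with rfl | h | h
      · exact absurd hpX hbX.1
      · exact h
      · exact absurd h hbX.2
    rcases mem_union.1 ha with ha | ha
    · exact ⟨a, ha, b, mem_insert_of_mem hbA, hbX.1, hab⟩
    · exact absurd hab.symm (hno b hbA a ha)
  · have hXA' : ∀ v ∈ X, v ∈ A := fun v hv =>
      (mem_insert.1 (hX hv)).resolve_left fun h => hpX (h ▸ hv)
    obtain ⟨a, ha, b, hb, hbX, hab⟩ := hW X (fun v hv => by rw [hAB]; have := hXA' v hv; tauto)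
      hne (fun h => hpX (h ▸ hp))
    refine ⟨a, ha, b, ?_, hbX, hab⟩
    rw [mem_insert]
    rcases (hAB b).1 hb with h | h | h
    · exact Or.inl h
    · exact Or.inr h
    · exact absurd hab (hno a (hXA' a ha) b h)

/-- A rainbow cut in one part at a cut vertex is a rainbow cut of the whole graph. -/
theorem RainbowCutOn.of_part {C : Type*} {c : V → C} {A B : Finset V}
    (hAB : ∀ v, v ∈ W ↔ v = p ∨ v ∈ A ∨ v ∈ B) (hpB : p ∉ B)
    (hdis : ∀ v ∈ A, v ∉ B) (hno : ∀ a ∈ A, ∀ b ∈ B, ¬ G.Adj a b) {x y : V}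
    (hx : x ∈ insert p A) (hy : y ∈ insert p A)
    (h : RainbowCutOn G (insert p A) c x y) : RainbowCutOn G W c x y := by
  have hnB : ∀ v ∈ insert p A, v ∉ B := by
    intro v hv
    rcases mem_insert.1 hv with rfl | h
    · exact hpB
    · exact hdis v h
  obtain ⟨S, ⟨hS, hxS, hyS, X, hxX, hyX, hX⟩, hr⟩ := h
  -- All of `B` follows `p`, its only contact with the other part.
  refine ⟨S, ⟨fun v hv => ?_, hxS, hyS, {v | (v ∈ B ∧ p ∈ X) ∨ (v ∉ B ∧ v ∈ X)},
    Or.inr ⟨hnB x hx, hxX⟩, ?_, ?_⟩, hr⟩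
  · rw [hAB]; have := mem_insert.1 (hS hv); tauto
  · have := hnB y hy
    simp only [Set.mem_ofPred_eq]
    tauto
  · intro a ha b hb haX hbX hab
    simp only [Set.mem_ofPred_eq] at haX hbX
    have hBp : ∀ a ∈ W, ∀ b ∈ B, G.Adj a b → a ∉ B → a = p := fun a ha b hb hab haB => by
      rcases (hAB a).1 ha with h | h | h
      · exact h
      · exact absurd hab (hno a h b hb)
      · exact absurd h haB
    by_cases haB : a ∈ B
    · by_cases hbB : b ∈ B
      · tauto
      · have := hBp b hb a haB hab.symm hbB
        subst this
        tauto
    · by_cases hbB : b ∈ B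
      · have := hBp a ha b hbB hab haB
        subst this
        tauto
      · have h1 := (hAB a).1 ha
        have h2 := (hAB b).1 hb
        exact hX a (by rw [mem_insert]; tauto) b (by rw [mem_insert]; tauto) (by tauto)
          (by tauto) hab

/-- Colorings of the two parts at a cut vertex that agree there fit together. -/
theorem ColoringOn.of_parts {C : Type*} {c : V → C} {A B : Finset V}
    (hAB : ∀ v, v ∈ W ↔ v = p ∨ v ∈ A ∨ v ∈ B) (hpA : p ∉ A) (hpB : p ∉ B)
    (hdis : ∀ v ∈ A, v ∉ B) (hno : ∀ a ∈ A, ∀ b ∈ B, ¬ G.Adj a b)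
    (hA : ColoringOn G (insert p A) c) (hB : ColoringOn G (insert p B) c) :
    ColoringOn G W c := by
  have cross : ∀ x ∈ A, ∀ y ∈ B, RainbowCutOn G W c x y := by
    intro x hx y hy
    refine ⟨{p}, ⟨by simp [hAB], ?_, ?_, A, hx, fun h => hdis y h hy, ?_⟩, by simp,
      fun h => absurd h (hno x hx y hy)⟩
    · rw [mem_singleton]; rintro rfl; exact hpA hx
    · rw [mem_singleton]; rintro rfl; exact hpB hy
    · intro a _ b hb haA hbA hab
      rw [hAB] at hb
      rcases hb with h | h | h
      · simp [h]
      · exact absurd h hbA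
      · exact absurd hab (hno a haA b h)
  have hAB' : ∀ v, v ∈ W ↔ v = p ∨ v ∈ B ∨ v ∈ A := fun v => by rw [hAB]; tauto
  have fA : ∀ x ∈ insert p A, ∀ y ∈ insert p A, x ≠ y → RainbowCutOn G W c x y :=
    fun x hx y hy hxy => (hA x hx y hy hxy).of_part hAB hpB hdis hno hx hy
  have fB : ∀ x ∈ insert p B, ∀ y ∈ insert p B, x ≠ y → RainbowCutOn G W c x y :=
    fun x hx y hy hxy => (hB x hx y hy hxy).of_part hAB' hpA (fun v h h' => hdis v h' h)
      (fun b hb a ha h => hno a ha b hb h.symm) hx hy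
  intro x hx y hy hxy
  rcases (hAB x).1 hx with hx1 | hx1 | hx1 <;> rcases (hAB y).1 hy with hy1 | hy1 | hy1
  · exact absurd (hx1.trans hy1.symm) hxy
  · exact fA x (by simp [hx1]) y (by simp [hy1]) hxy
  · exact fB x (by simp [hx1]) y (by simp [hy1]) hxy
  · exact fA x (by simp [hx1]) y (by simp [hy1]) hxy
  · exact fA x (by simp [hx1]) y (by simp [hy1]) hxy
  · exact cross x hx1 y hy1
  · exact fB x (by simp [hx1]) y (by simp [hy1]) hxy
  · exact (cross y hy1 x hx1).symm
  · exact fB x (by simp [hx1]) y (by simp [hy1]) hxy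

/-- Degree sums of the two parts at a cut vertex. -/
theorem degSum_parts {A B : Finset V}
    (hAB : ∀ v, v ∈ W ↔ v = p ∨ v ∈ A ∨ v ∈ B) (hpA : p ∉ A) (hpB : p ∉ B)
    (hdis : ∀ v ∈ A, v ∉ B) (hno : ∀ a ∈ A, ∀ b ∈ B, ¬ G.Adj a b) :
    degSum G W = degSum G (insert p A) + degSum G (insert p B) := by
  have hWe : W = insert p (A ∪ B) := by ext v; simp [hAB]
  have hd : Disjoint A B := disjoint_left.2 hdis
  have e : ∀ (A B : Finset V), (∀ v, v ∈ W ↔ v = p ∨ v ∈ A ∨ v ∈ B) →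
      (∀ a ∈ A, ∀ b ∈ B, ¬ G.Adj a b) → ∀ v ∈ A, nbrOn G W v = nbrOn G (insert p A) v := by
    intro A B hAB hno v hv
    ext u
    have := hno v hv u
    simp only [mem_nbrOn, hAB, mem_insert]
    tauto
  have hpN : (nbrOn G W p).card = (nbrOn G (insert p A) p).card + (nbrOn G (insert p B) p).card := by
    rw [← card_union_of_disjoint]
    · congr 1
      ext u
      have : ¬ G.Adj p p := G.loopless.irrefl p
      simp only [mem_nbrOn, hAB, mem_insert, mem_union]
      tauto
    · rw [disjoint_left]
      intro u hu hu'
      simp only [mem_nbrOn, mem_insert] at hu hu'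
      have := hu.2.ne'
      exact hdis u (hu.1.resolve_left this) (hu'.1.resolve_left this)
  have hA := sum_congr rfl fun v hv => congrArg card (e A B hAB hno v hv)
  have hB := sum_congr rfl fun v hv => congrArg card (e B A (fun v => by rw [hAB]; tauto)
    (fun b hb a ha h => hno a ha b hb h.symm) v hv)
  have : degSum G W = (nbrOn G W p).card + ∑ v ∈ A ∪ B, (nbrOn G W v).card := by
    have h : ∑ v ∈ insert p (A ∪ B), (nbrOn G W v).card = _ :=
      sum_insert (by simp [hpA, hpB])
    rwa [← hWe] at h
  rw [this, degSum, degSum, sum_insert hpA, sum_insert hpB, sum_union hd, hpN, hA, hB]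
  ring

/-! ### The induction on the order. -/

/-- A connected graph with cyclomatic number less than `k` has a rainbow vertex-disconnection
coloring with `k ≥ 2` colors that gives two prescribed vertices different colors. -/
theorem exists_coloringOn_ne {k : ℕ} (hk : 2 ≤ k) (hW : ConnOn G W)
    (hd : degSum G W + 4 ≤ 2 * W.card + 2 * k) (hp : p ∈ W) (hq : q ∈ W) (hpq : p ≠ q) :
    ∃ c : V → ℕ, ColoringOn G W c ∧ (∀ v, c v < k) ∧ c p ≠ c q := by
  induction hn : W.card using Nat.strong_induction_on generalizing W p q k with
  | _ n ih =>
  subst hn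
  by_cases htree : degSum G W + 2 ≤ 2 * W.card
  · refine ⟨fun v => if v = p then 1 else 0, coloringOn_of_tree hW htree _, fun v => ?_, ?_⟩
    · dsimp only
      split_ifs <;> omega
    · simp [hpq.symm]
  have hcard := card_erase_add_one hp
  have hds := degSum_erase (G := G) hp
  have hdpos := card_nbrOn_pos hW hp hq hpq
  have hqe : q ∈ W.erase p := by simp [hpq.symm, hq]
  by_cases hleaf : ∃ l ∈ W, l ≠ p ∧ l ≠ q ∧ (nbrOn G W l).card = 1
  · obtain ⟨l, hl, hlp, hlq, hd1⟩ := hleaf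
    have hcl := card_erase_add_one hl
    have hdl := degSum_erase (G := G) hl
    obtain ⟨c, hc, hck, hcne⟩ := ih _ (card_erase_lt_of_mem hl) (p := p) (q := q) hk
      (hW.erase_leaf hl hd1) (by omega) (by simp [hlp.symm, hp]) (by simp [hlq.symm, hq]) hpq rfl
    exact ⟨c, hc.of_erase_leaf hd1, hck, hcne⟩
  push Not at hleaf
  by_cases hcut : ConnOn G (W.erase p)
  · by_cases hd1 : (nbrOn G W p).card = 1
    · have h3 : 1 < (W.erase p).card := by
        by_contra! h
        have : 0 < (W.erase p).card := card_pos.2 ⟨q, hqe⟩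
        have h0 : degSum G (W.erase p) = 0 := by
          refine sum_eq_zero fun v hv => card_eq_zero.2 ?_
          ext u
          simp only [mem_nbrOn, notMem_empty, iff_false, not_and]
          intro hu hvu
          exact hvu.ne (card_le_one.1 h v hv u hu)
        omega
      obtain ⟨r, hr, hrq⟩ := exists_mem_ne h3 q
      obtain ⟨c, hc, hck, -⟩ := ih _ (card_erase_lt_of_mem hp) (p := q) (q := r) hk
        hcut (by omega) hqe hr hrq.symm rfl
      -- A leaf may take any color, so one different from that of `q` is chosen.
      refine ⟨Function.update c p (if c q = 0 then 1 else 0), ?_, fun v => ?_, ?_⟩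
      · refine ColoringOn.of_erase_leaf hd1 fun x hx y hy hxy => ?_
        refine (hc x hx y hy hxy).refine hx hy fun u hu v hv h => ?_
        rwa [Function.update_of_ne (ne_of_mem_erase hu),
          Function.update_of_ne (ne_of_mem_erase hv)] at h
      · by_cases hv : v = p
        · subst hv
          rw [Function.update_self]
          split_ifs <;> omega
        · rw [Function.update_of_ne hv]
          exact hck v
      · rw [Function.update_self, Function.update_of_ne hpq.symm]
        split_ifs <;> omega
    have hlow := le_degSum hcut
    by_cases htree' : degSum G (W.erase p) + 2 ≤ 2 * (W.erase p).card
    · -- the rest is a tree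
      have h2 : 2 ≤ (W.erase p).card := by
        have : nbrOn G W p ⊆ W.erase p := fun v hv => by
          rw [mem_nbrOn] at hv
          simp [hv.1, hv.2.ne']
        have := card_le_card this
        omega
      obtain ⟨l, hl, hlq, hl1⟩ := exists_leaf hcut hqe h2 htree'
      have hlp := ne_of_mem_erase hl
      -- Otherwise `l` would be a leaf of the whole graph other than `p` and `q`, a case already
      -- settled.
      have hlN : l ∈ nbrOn G W p := by
        by_contra h
        refine hleaf l (mem_of_mem_erase hl) hlp hlq ?_
        rwa [nbrOn_erase, erase_eq_of_notMem] at hl1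
        intro h'
        exact h (by simpa [mem_of_mem_erase hl, G.adj_comm p l] using (mem_nbrOn.1 h').2)
      have hcN := card_erase_add_one hlN
      obtain ⟨f, hf, hfN⟩ := exists_injOn_lt_card ((nbrOn G W p).erase l)
      -- Here `p` has degree at most `k`. Its neighbors get distinct colors, `l` taking 0, and color
      -- 0 is used only at `p` and `l`; so `q` differs from `p`.
      refine ⟨fun v => if v = p ∨ v = l then 0 else if v ∈ nbrOn G W p then f v + 1 else 1,
        coloringOn_of_erase_tree hp hcut htree' hl1 ?_ ?_, ?_, ?_⟩
      · have hne : ∀ a ∈ nbrOn G W p, a ≠ p := fun a ha => (mem_nbrOn.1 ha).2.ne'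
        intro a ha b hb hab
        rw [mem_coe] at ha hb
        by_cases hal : a = l <;> by_cases hbl : b = l
        · rw [hal, hbl]
        · simp only [hal, or_true, if_true, hbl, hne b hb, or_self, if_false, hb] at hab
          omega
        · simp only [hal, or_true, if_true, hbl, hne a ha, or_self, if_false, ha] at hab
          omega
        · simp only [hal, hbl, hne a ha, hne b hb, or_self, if_false, ha, hb, if_true] at hab
          exact hf (by simp only [coe_erase]; exact ⟨ha, hal⟩)
            (by simp only [coe_erase]; exact ⟨hb, hbl⟩) (by omega)
      · intro v _ hv
        by_contra h
        simp only [h, if_false, true_or, if_true] at hv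
        split_ifs at hv
      · intro v
        dsimp only
        split_ifs with h1 h2
        · omega
        · push Not at h1
          have := hfN v (mem_erase.2 ⟨h1.2, h2⟩)
          omega
        · omega
      · simp only [true_or, if_true, hpq.symm, hlq.symm, or_self, if_false]
        split_ifs <;> omega
    · have hd2 : 1 < (nbrOn G W p).card := by omega
      obtain ⟨x, hx, y, hy, hxy⟩ := one_lt_card.1 hd2
      have hxW : x ∈ W.erase p := by
        rw [mem_nbrOn] at hx; simp [hx.1, hx.2.ne']
      have hyW : y ∈ W.erase p := by
        rw [mem_nbrOn] at hy; simp [hy.1, hy.2.ne']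
      -- Deleting `p` lowers the cyclomatic number by its degree minus one. The rest is not a tree,
      -- so `k' ≥ 2` and the induction hypothesis applies.
      obtain ⟨k', hk'⟩ : ∃ k', k = k' + ((nbrOn G W p).card - 1) :=
        ⟨k - ((nbrOn G W p).card - 1), by omega⟩
      obtain ⟨c, hc, hck, hcne⟩ := ih _ (card_erase_lt_of_mem hp) (p := x) (q := y) (k := k')
        (by omega) hcut (by omega) hxW hyW hxy rfl
      obtain ⟨f, hf, hfN⟩ := exists_injOn_lt_card (((nbrOn G W p).erase x).erase y)
      have hc1 := card_erase_add_one hx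
      have hc2 := card_erase_add_one (mem_erase.2 ⟨hxy.symm, hy⟩)
      have hmem : ∀ v, v ∈ ((nbrOn G W p).erase x).erase y ↔
          v ∈ nbrOn G W p ∧ v ≠ x ∧ v ≠ y := fun v => by
        simp only [mem_erase]; tauto
      have hnp : p ∉ ((nbrOn G W p).erase x).erase y := by simp [hmem]
      generalize hM : ((nbrOn G W p).erase x).erase y = M at *
      -- The neighbors `x`, `y` keep their distinct old colors, the remaining ones get distinct new
      -- colors from `k'` to `k - 2`, and `p` gets `k - 1`. On the rest this refines `c`.
      refine ⟨fun v => if v = p then k - 1 else if v ∈ M then k' + f v else c v,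
        hc.of_erase hp ?_ ?_ ?_, ?_, ?_⟩
      · intro u hu v hv h
        simp only [ne_of_mem_erase hu, ne_of_mem_erase hv, if_false] at h
        have := hck u
        have := hck v
        split_ifs at h with h1 h2 h2
        · rw [hf h1 h2 (by omega)]
        · omega
        · omega
        · exact h
      · intro v hv
        simp only [ne_of_mem_erase hv, if_false, if_true]
        have := hck v
        split_ifs with h
        · have := hfN v h
          omega
        · omega
      · intro u hu v hv h
        rw [mem_coe] at hu hv
        have hup : u ≠ p := (mem_nbrOn.1 hu).2.ne'
        have hvp : v ≠ p := (mem_nbrOn.1 hv).2.ne'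
        simp only [hup, hvp, if_false] at h
        have := hck u
        have := hck v
        split_ifs at h with h1 h2 h2
        · exact hf h1 h2 (by omega)
        · omega
        · omega
        · rw [hmem] at h1 h2
          have h1' : u = x ∨ u = y := by tauto
          have h2' : v = x ∨ v = y := by tauto
          rcases h1' with rfl | rfl <;> rcases h2' with rfl | rfl
          · rfl
          · exact absurd h hcne
          · exact absurd h.symm hcne
          · rfl
      · intro v
        dsimp only
        have := hck v
        split_ifs with h1 h2
        · omega
        · have := hfN v h2
          omega
        · omega
      · simp only [if_true, hpq.symm, if_false]
        have := hck q
        split_ifs with h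
        · have := hfN q h
          omega
        · omega
  · -- `p` is a cut vertex
    obtain ⟨A, B, hAB, hpA, hpB, hdis, hno, ⟨a, haA⟩, hqB⟩ : ∃ A B : Finset V,
        (∀ v, v ∈ W ↔ v = p ∨ v ∈ A ∨ v ∈ B) ∧ p ∉ A ∧ p ∉ B ∧ (∀ v ∈ A, v ∉ B) ∧
        (∀ a ∈ A, ∀ b ∈ B, ¬ G.Adj a b) ∧ A.Nonempty ∧ q ∈ B := by
      unfold ConnOn at hcut
      push Not at hcut
      obtain ⟨A, hA, hne, hAW, hA2⟩ := hcut
      have hpA : p ∉ A := fun h => by simpa using hA h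
      have hAW' : ∀ v ∈ A, v ∈ W := fun v hv => mem_of_mem_erase (hA hv)
      by_cases hqA : q ∈ A
      · refine ⟨W.erase p \ A, A, fun v => ?_, by simp, hpA, fun v hv => (mem_sdiff.1 hv).2,
          fun a ha b hb h => ?_, ?_, hqA⟩
        · have := hAW' v
          simp only [mem_sdiff, mem_erase]
          constructor
          · tauto
          · rintro (rfl | h | h) <;> tauto
        · exact hA2 b hb a (mem_sdiff.1 ha).1 (mem_sdiff.1 ha).2 h.symm
        · rw [sdiff_nonempty]
          exact fun h => hAW (subset_antisymm hA h)
      · refine ⟨A, W.erase p \ A, fun v => ?_, hpA, by simp, fun v hv h => (mem_sdiff.1 h).2 hv,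
          fun a ha b hb h => ?_, hne, mem_sdiff.2 ⟨hqe, hqA⟩⟩
        · have := hAW' v
          simp only [mem_sdiff, mem_erase]
          constructor
          · tauto
          · rintro (rfl | h | h) <;> tauto
        · exact hA2 a ha b (mem_sdiff.1 hb).1 (mem_sdiff.1 hb).2 h
    have hAB' : ∀ v, v ∈ W ↔ v = p ∨ v ∈ B ∨ v ∈ A := fun v => by rw [hAB]; tauto
    have hcA := hW.insert_part hp hAB hpA hpB hdis hno
    have hcB := hW.insert_part hp hAB' hpB hpA (fun v h h' => hdis v h' h)
      (fun b hb a ha h => hno a ha b hb h.symm)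
    have hsum := degSum_parts hAB hpA hpB hdis hno
    have hWc : W.card = A.card + B.card + 1 := by
      rw [← card_union_of_disjoint (disjoint_left.2 hdis), ← card_insert_of_notMem (a := p)]
      · congr 1
        ext v
        simp [hAB]
      · simp [hpA, hpB]
    have hA1 := card_insert_of_notMem hpA
    have hB1 := card_insert_of_notMem hpB
    have hlA := le_degSum hcA
    have hlB := le_degSum hcB
    have hA0 : 0 < A.card := card_pos.2 ⟨a, haA⟩
    have hB0 : 0 < B.card := card_pos.2 ⟨q, hqB⟩
    -- Each part has at most the cyclomatic number of the whole, so the same `k` serves both; the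
    -- vertex `a` is arbitrary.
    obtain ⟨cA, hcolA, hkA, -⟩ := ih _ (by omega) (p := p) (q := a) hk hcA (by omega)
      (by simp) (by simp [haA]) (fun h => hpA (h ▸ haA)) rfl
    obtain ⟨cB, hcolB, hkB, hne⟩ := ih _ (by omega) (p := p) (q := q) hk hcB (by omega)
      (by simp) (by simp [hqB]) hpq rfl
    -- The transposition makes the two colorings agree at `p` and introduces no new colors.
    refine ⟨fun v => if v ∈ B then cB v else Equiv.swap (cA p) (cB p) (cA v),
      ColoringOn.of_parts hAB hpA hpB hdis hno ?_ ?_, ?_, ?_⟩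
    · intro x hx y hy hxy
      have hnB : ∀ v ∈ insert p A, v ∉ B := by
        intro v hv
        rcases mem_insert.1 hv with rfl | h
        · exact hpB
        · exact hdis v h
      refine (hcolA x hx y hy hxy).refine hx hy fun u hu v hv h => ?_
      simpa only [hnB u hu, hnB v hv, if_false, EmbeddingLike.apply_eq_iff_eq] using h
    · intro x hx y hy hxy
      have heq : ∀ v ∈ insert p B,
          (if v ∈ B then cB v else Equiv.swap (cA p) (cB p) (cA v)) = cB v := by
        intro v hv
        rcases mem_insert.1 hv with rfl | h
        · simp [hpB]
        · simp [h]
      refine (hcolB x hx y hy hxy).refine hx hy fun u hu v hv h => ?_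
      rwa [heq u hu, heq v hv] at h
    · intro v
      dsimp only
      split_ifs
      · exact hkB v
      · rw [Equiv.swap_apply_def]
        split_ifs
        · exact hkB p
        · exact hkA p
        · exact hkA v
    · simpa [hpB, hqB] using hne

end Bound

/-! ### Passage to the original definitions. -/

section Extremal

open Classical Finset

variable {V : Type*} {C : Type*} {G : SimpleGraph V} {x y : V}

/-- A walk outside `S` from `x` to `y` would leave `A` along some edge, and every such edge has an
end in `S`. -/
theorem separatedBy_of_side {S A : Set V} (hx : x ∉ S) (hy : y ∉ S) (hxA : x ∈ A) (hyA : y ∉ A)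
    (hA : ∀ a b, a ∈ A → b ∉ A → G.Adj a b → a ∈ S ∨ b ∈ S) : SeparatedBy G x y S := by
  refine ⟨hx, hy, ?_⟩
  rintro ⟨w⟩
  obtain ⟨d, -, h1, h2⟩ := w.exists_boundary_dart {v | (v : V) ∈ A} hxA hyA
  rcases hA _ _ h1 h2 d.adj with h | h
  · exact d.fst.2 h
  · exact d.snd.2 h

theorem isRainbow_of_injOn {c : V → C} {S : Set V} (h : Set.InjOn c S) : IsRainbow c S :=
  fun _ hu _ hv huv e => huv (h hu hv e)

theorem ColoringOn.isRVDColoring [Fintype V] {c : V → C} (h : ColoringOn G univ c) :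
    IsRVDColoring G c := by
  intro x y hxy
  obtain ⟨S, ⟨-, hx, hy, A, hxA, hyA, hA⟩, hi, hr⟩ := h x (mem_univ _) y (mem_univ _) hxy
  refine ⟨S, ⟨fun hn => ?_, fun _ => ?_⟩, fun _ => isRainbow_of_injOn hi, fun h => ?_⟩
  · refine separatedBy_of_side hx hy hxA hyA fun a b ha hb hab => ?_
    rcases hA a (mem_univ _) b (mem_univ _) ha hb hab with h | h | ⟨rfl, rfl⟩
    · exact Or.inl h
    · exact Or.inr h
    · exact absurd hab hn
  · refine separatedBy_of_side hx hy hxA hyA fun a b ha hb hab => ?_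
    rw [SimpleGraph.deleteEdges_adj] at hab
    rcases hA a (mem_univ _) b (mem_univ _) ha hb hab.1 with h | h | ⟨rfl, rfl⟩
    · exact Or.inl h
    · exact Or.inr h
    · exact absurd rfl hab.2
  · have := hr h
    rw [coe_insert, coe_insert] at this
    exact this.imp isRainbow_of_injOn isRainbow_of_injOn

theorem rvd_le_of_coloringOn [Fintype V] {k : ℕ} {c : V → ℕ} (h : ColoringOn G univ c)
    (hk : ∀ v, c v < k) : rvd G ≤ k := by
  refine Nat.sInf_le ⟨fun v => ⟨c v, hk v⟩, ColoringOn.isRVDColoring fun x hx y hy hxy => ?_⟩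
  exact (h x hx y hy hxy).refine hx hy fun u _ v _ e => by simpa using e

theorem rvd_le_card [Fintype V] : rvd G ≤ Fintype.card V :=
  Nat.sInf_le ⟨Fintype.equivFin V, isRVDColoring_of_injective G _ (Fintype.equivFin V).injective⟩

/-! ### Common neighbors force colors. -/

theorem mem_of_separatedBy {z : V} {S : Set V} (h : SeparatedBy G x y S) (hx : G.Adj x z)
    (hy : G.Adj z y) : z ∈ S := by
  obtain ⟨hxS, hyS, h⟩ := h
  by_contra hz
  refine h (SimpleGraph.Reachable.trans (v := ⟨z, hz⟩) (SimpleGraph.Adj.reachable ?_)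
    (SimpleGraph.Adj.reachable ?_))
  · simpa using hx
  · simpa using hy

/-- A vertex-cut contains all common neighbors. -/
theorem IsVertexCut.mem {z : V} {S : Set V} (h : IsVertexCut G x y S) (hx : G.Adj x z)
    (hy : G.Adj z y) : z ∈ S := by
  by_cases hxy : G.Adj x y
  · refine mem_of_separatedBy (h.2 hxy) ?_ ?_
    · simp [SimpleGraph.deleteEdges_adj, hx, hx.ne', hy.ne]
    · simp [SimpleGraph.deleteEdges_adj, hy, hx.ne', hy.ne]
  · exact mem_of_separatedBy (h.1 hxy) hx hy

theorem IsRainbowVertexCut.isRainbow {c : V → C} {S : Set V} (h : IsRainbowVertexCut G c x y S) :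
    IsRainbow c S := by
  by_cases hxy : G.Adj x y
  · rcases h.2.2 hxy with h | h <;>
      exact fun u hu v hv => h u (Set.mem_insert_of_mem _ hu) v (Set.mem_insert_of_mem _ hv)
  · exact h.2.1 hxy

theorem card_le_rvd_of_isRainbow [Finite V] {T : Finset V}
    (h : ∀ c : V → Fin (rvd G), IsRVDColoring G c → IsRainbow c T) : T.card ≤ rvd G := by
  obtain ⟨c, hc⟩ := exists_isRVDColoring_rvd G
  have : Set.InjOn c T := fun u hu v hv e => by
    by_contra huv
    exact h c hc u hu v hv huv e
  simpa using card_le_card_of_injOn c (t := univ) (by simp) this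

/-- If any two vertices have two common neighbors, then all colors are different. -/
theorem card_le_rvd [Fintype V] (h : ∀ x y : V, x ≠ y → ∃ u v, u ≠ v ∧ G.Adj x u ∧ G.Adj x v ∧
    G.Adj y u ∧ G.Adj y v) : Fintype.card V ≤ rvd G := by
  rw [← card_univ]
  refine card_le_rvd_of_isRainbow fun c hc x _ y _ hxy => ?_
  obtain ⟨u, v, huv, hxu, hxv, hyu, hyv⟩ := h x y hxy
  -- The roles are exchanged: `x` and `y` are common neighbors of `u` and `v`, so a rainbow cut
  -- between `u` and `v` contains both.
  obtain ⟨S, hS⟩ := hc u v huv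
  exact hS.isRainbow x (hS.1.mem hxu.symm hxv) y (hS.1.mem hyu.symm hyv) hxy

/-- Two adjacent vertices with many common neighbors force many colors. -/
theorem card_add_one_le_rvd [Finite V] {T : Finset V} (hxy : G.Adj x y)
    (hT : ∀ z ∈ T, G.Adj x z ∧ G.Adj z y) : T.card + 1 ≤ rvd G := by
  obtain ⟨c, hc⟩ := exists_isRVDColoring_rvd G
  obtain ⟨S, hS⟩ := hc x y hxy.ne
  have key : ∀ w, w ∉ T → IsRainbow c (insert w S) → T.card + 1 ≤ rvd G := by
    intro w hw h
    have hsub : ∀ u ∈ insert w T, u ∈ insert w S := fun u hu => by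
      rcases mem_insert.1 hu with rfl | hu
      · exact Set.mem_insert _ _
      · exact Set.mem_insert_of_mem _ (hS.1.mem (hT u hu).1 (hT u hu).2)
    have : Set.InjOn c (insert w T : Finset V) := fun u hu v hv e => by
      by_contra huv
      exact h u (hsub u hu) v (hsub v hv) huv e
    rw [← card_insert_of_notMem hw]
    simpa using card_le_card_of_injOn c (t := univ) (by simp) this
  rcases hS.2.2 hxy with h | h
  · exact key x (fun hx => (hT x hx).1.ne rfl) h
  · exact key y (fun hy => (hT y hy).2.ne rfl) h

/-! ### The cyclomatic bound for the whole graph. -/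

theorem connOn_univ [Fintype V] (h : G.Connected) : ConnOn G univ := by
  intro A _ ⟨a, ha⟩ hA
  obtain ⟨b, hb⟩ : ∃ b, b ∉ A := by
    by_contra! hc
    exact hA (eq_univ_of_forall hc)
  obtain ⟨w⟩ := h.preconnected a b
  obtain ⟨d, -, h1, h2⟩ := w.exists_boundary_dart (A : Set V) ha hb
  exact ⟨_, h1, _, mem_univ _, h2, d.adj⟩

theorem degSum_univ [Fintype V] : degSum G univ = 2 * G.edgeSet.ncard := by
  rw [← SimpleGraph.coe_edgeFinset, Set.ncard_coe_finset, ← G.sum_degrees_eq_twice_card_edges]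
  refine sum_congr rfl fun v _ => ?_
  rw [← SimpleGraph.card_neighborFinset_eq_degree]
  congr 1
  ext u
  simp

/-- The rainbow vertex-disconnection number is at most the cyclomatic number plus one. -/
theorem rvd_le [Fintype V] [Nontrivial V] {k : ℕ} (hk : 1 ≤ k) (h : G.Connected)
    (hm : G.edgeSet.ncard + 2 ≤ Fintype.card V + k) : rvd G ≤ k := by
  have hW := connOn_univ h
  have hd := degSum_univ (G := G)
  rw [← card_univ] at hm
  rcases hk.eq_or_lt with rfl | hk
  · exact rvd_le_of_coloringOn (c := fun _ => 0) (coloringOn_of_tree hW (by omega) _) (by simp)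
  · obtain ⟨p, q, hpq⟩ := exists_pair_ne V
    obtain ⟨c, hc, hck, -⟩ := exists_coloringOn_ne hk hW (by omega) (mem_univ p) (mem_univ q) hpq
    exact rvd_le_of_coloringOn hc hck

/-! ### Graphs that need all colors. -/

/-- Two vertices with at most one common neighbor can get the same color. -/
theorem rvd_lt_card [Fintype V] (hxy : x ≠ y)
    (h : (nbrOn G univ x ∩ nbrOn G univ y).card ≤ 1) : rvd G < Fintype.card V := by
  obtain ⟨f, hf, hfN⟩ := exists_injOn_lt_card (univ.erase y)
  have hcard : (univ.erase y).card + 1 = Fintype.card V := card_erase_add_one (mem_univ y)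
  set c : V → ℕ := fun v => if v = y then f x else f v with hc
  suffices hcol : ColoringOn G univ c by
    have := rvd_le_of_coloringOn (k := (univ.erase y).card) hcol fun v => by
      simp only [hc]
      split_ifs with hv
      · exact hfN x (by simp [hxy])
      · exact hfN v (by simp [hv])
    omega
  -- The only repeated color is that of `x` and `y`, so a set missing one of them is rainbow.
  have inj : ∀ T : Finset V, x ∉ T ∨ y ∉ T → Set.InjOn c T := by
    intro T hT u hu v hv huv
    rw [mem_coe] at hu hv
    have hf' : ∀ a b, a ≠ y → b ≠ y → f a = f b → a = b := fun a b ha hb e =>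
      hf (by simpa using ha) (by simpa using hb) e
    simp only [hc] at huv
    split_ifs at huv with h1 h2 h2
    · rw [h1, h2]
    · have := hf' x v hxy h2 huv
      subst h1 this
      tauto
    · have := hf' u x h1 hxy huv
      subst h2 this
      tauto
    · exact hf' u v h1 h2 huv
  -- a cut that leaves only `z` besides `u` and `v`
  have cut : ∀ u v z, u ≠ v → z ≠ v → ¬ (G.Adj z v ∧ z ≠ u) →
      CutOn G univ u v (univ \ {u, v, z}) := by
    intro u v z huv hzv hz
    refine ⟨subset_univ _, by simp, by simp, {u, z}, by simp, by simp [huv.symm, hzv.symm], ?_⟩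
    intro a _ b _ ha hb hab
    simp only [mem_sdiff, mem_univ, true_and, mem_insert, mem_singleton]
    simp only [Set.mem_insert_iff, Set.mem_singleton_iff] at ha hb
    by_cases hbv : b = v
    · subst hbv
      rcases ha with rfl | rfl
      · tauto
      · by_cases hau : a = u <;> tauto
    · tauto
  -- One of `x`, `y` stays out of the cut, on the side of `u`; this is possible if it is not
  -- adjacent to `v`.
  have side : ∀ u v z, u ≠ v → u ≠ x → u ≠ y → z ≠ v → (z = x ∨ z = y) →
      ¬ G.Adj z v → RainbowCutOn G univ c u v := by
    intro u v z huv hux huy hzv hz hn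
    refine ⟨_, cut u v z huv hzv (fun h => hn h.1), inj _ ?_, fun _ => Or.inl (inj _ ?_)⟩
    · rcases hz with rfl | rfl <;> simp
    · rcases hz with rfl | rfl <;> simp [hux.symm, huy.symm]
  intro u _ v _ huv
  by_cases hu : u = x ∨ u = y
  · refine ⟨_, cut u v u huv huv (by simp), inj _ ?_, fun _ => ?_⟩
    · rcases hu with rfl | rfl <;> simp
    · by_cases hv : v = x ∨ v = y
      · refine Or.inl (inj _ ?_)
        simp only [mem_insert, mem_sdiff, mem_univ, true_and, mem_singleton]; grind
      · refine Or.inr (inj _ ?_)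
        simp only [mem_insert, mem_sdiff, mem_univ, true_and, mem_singleton]; grind
  by_cases hv : v = x ∨ v = y
  · refine RainbowCutOn.symm ⟨_, cut v u v huv.symm huv.symm (by simp), inj _ ?_,
      fun _ => Or.inr (inj _ ?_)⟩
    · rcases hv with rfl | rfl <;> simp
    · simp only [mem_insert, mem_sdiff, mem_univ, true_and, mem_singleton]; grind
  push Not at hu hv
  -- Not both of `u`, `v` are common neighbors of `x` and `y`. A missing edge among the four
  -- supplies the `z` for `side`.
  have hnot : ¬ (G.Adj x u ∧ G.Adj y u ∧ G.Adj x v ∧ G.Adj y v) := fun hh =>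
    huv (card_le_one.1 h u (by simp [hh]) v (by simp [hh]))
  by_cases h1 : G.Adj x u
  · by_cases h2 : G.Adj y u
    · by_cases h3 : G.Adj x v
      · exact side u v y huv hu.1 hu.2 hv.2.symm (Or.inr rfl) (by tauto)
      · exact side u v x huv hu.1 hu.2 hv.1.symm (Or.inl rfl) h3
    · exact (side v u y huv.symm hv.1 hv.2 hu.2.symm (Or.inr rfl) h2).symm
  · exact (side v u x huv.symm hv.1 hv.2 hu.1.symm (Or.inl rfl) h1).symm

/-- The least number of edges if any two vertices have two common neighbors. -/
theorem le_ncard_edgeSet [Fintype V] (hn : 4 ≤ Fintype.card V)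
    (h : ∀ x y : V, x ≠ y → 2 ≤ (nbrOn G univ x ∩ nbrOn G univ y).card) :
    5 * Fintype.card V ≤ 2 * G.edgeSet.ncard + 8 := by
  rw [← degSum_univ]
  have : Nontrivial V := Fintype.one_lt_card_iff_nontrivial.1 (by omega)
  obtain ⟨v, -, hv⟩ := exists_min_image univ (fun v => (nbrOn G univ v).card) univ_nonempty
  set N := nbrOn G univ v with hN
  have hvN : v ∉ N := by simp [hN]
  have h1 : Fintype.card V * N.card ≤ degSum G univ := by
    rw [← card_univ, ← smul_eq_mul, ← sum_const]
    exact sum_le_sum hv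
  have hsym : ∀ a b, a ∈ nbrOn G univ b ↔ b ∈ nbrOn G univ a := fun a b => by
    simp [G.adj_comm]
  -- A neighbor `a` of `v` shares two neighbors with `v`, and these lie in `N` and differ from `a`.
  have h3 : 3 ≤ N.card := by
    obtain ⟨w, hw⟩ := exists_ne v
    obtain ⟨a, ha⟩ := card_pos.1 (lt_of_lt_of_le (by norm_num : 0 < 2) (h v w hw.symm))
    rw [mem_inter] at ha
    have hav : a ≠ v := fun e => hvN (e ▸ ha.1)
    have h4 := h v a hav.symm
    have h5 : (nbrOn G univ v ∩ nbrOn G univ a).card < N.card := by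
      refine card_lt_card ⟨inter_subset_left, fun hsub => ?_⟩
      have := (mem_inter.1 (hsub ha.1)).2
      simp at this
    omega
  set O := univ \ insert v N with hO
  have hOcard : O.card + N.card + 1 = Fintype.card V := by
    have := card_sdiff_add_card_eq_card (subset_univ (insert v N))
    rw [card_insert_of_notMem hvN, card_univ] at this
    omega
  have hsplit : degSum G univ = N.card + ∑ a ∈ N, (nbrOn G univ a).card +
      ∑ u ∈ O, (nbrOn G univ u).card := by
    rw [degSum, ← sum_sdiff (subset_univ (insert v N)), sum_insert hvN, add_comm]
  have hNO : ∑ a ∈ N, (nbrOn G univ a ∩ O).card = ∑ u ∈ O, (nbrOn G univ u ∩ N).card := by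
    have e : ∀ (A B : Finset V), ∑ a ∈ A, (nbrOn G univ a ∩ B).card =
        ∑ a ∈ A, ∑ b ∈ B, if G.Adj a b then 1 else 0 := fun A B => by
      refine sum_congr rfl fun a _ => ?_
      rw [← card_filter]
      congr 1
      ext b
      simp [and_comm]
    rw [e, e, sum_comm]
    simp only [G.adj_comm]
  have hO2 : 2 * O.card ≤ ∑ u ∈ O, (nbrOn G univ u ∩ N).card := by
    rw [mul_comm, ← smul_eq_mul, ← sum_const]
    refine sum_le_sum fun u hu => ?_
    have : u ≠ v := fun e => by simp [hO, e] at hu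
    exact h u v this
  have hOd : O.card * N.card ≤ ∑ u ∈ O, (nbrOn G univ u).card := by
    rw [← smul_eq_mul, ← sum_const]
    exact sum_le_sum fun u _ => hv u (mem_univ u)
  -- Each vertex of `N` sees `v`, at least two vertices of `N` (common neighbors with `v`), and its
  -- neighbors in `O`.
  have hNd : 3 * N.card + ∑ a ∈ N, (nbrOn G univ a ∩ O).card ≤
      ∑ a ∈ N, (nbrOn G univ a).card := by
    rw [mul_comm, ← smul_eq_mul, ← sum_const, ← sum_add_distrib]
    refine sum_le_sum fun a ha => ?_
    have hav : a ≠ v := fun e => hvN (e ▸ ha)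
    have h2 := h a v hav
    have hva : v ∈ nbrOn G univ a := (hsym a v).1 ha
    have hdis : Disjoint (insert v (nbrOn G univ a ∩ N)) (nbrOn G univ a ∩ O) := by
      rw [disjoint_left]
      intro u hu hu'
      have := (mem_sdiff.1 (mem_inter.1 hu').2).2
      simp only [mem_insert, mem_inter] at hu this
      tauto
    have hle : (insert v (nbrOn G univ a ∩ N) ∪ (nbrOn G univ a ∩ O)).card ≤
        (nbrOn G univ a).card :=
      card_le_card (union_subset (insert_subset hva inter_subset_left) inter_subset_left)
    rw [card_union_of_disjoint hdis, card_insert_of_notMem (by simp [hvN])] at hle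
    rw [← hN] at h2
    omega
  generalize hd : N.card = d at *
  -- The degree sum is at least `4d + (d + 2)(n - 1 - d)`, which is exactly `5n - 8` for `d = 3`.
  -- For `d = 4` it suffices when `n ≥ 6`, and `n * d` covers `n = 5`.
  rcases Nat.lt_or_ge d 5 with hd5 | hd5
  · interval_cases d <;> omega
  · have := Nat.mul_le_mul_left (Fintype.card V) hd5
    omega

/-! ### Extremal graphs. -/

/-- A graph with `k = rvd` that has the least number of edges. -/
theorem exists_rvd_eq [Fintype V] {k : ℕ} (hn : 4 ≤ Fintype.card V) (hk : 1 ≤ k)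
    (hkn : k + 1 ≤ Fintype.card V) : ∃ G : SimpleGraph V,
      G.Connected ∧ rvd G = k ∧ G.edgeSet.ncard + 2 = Fintype.card V + k := by
  have hnt : Nontrivial V := Fintype.one_lt_card_iff_nontrivial.1 (by omega)
  set n := Fintype.card V with hn'
  have e : V ≃ Fin n := Fintype.equivFin V
  set v0 := e.symm ⟨0, by omega⟩ with hv0
  set v1 := e.symm ⟨1, by omega⟩ with hv1
  have h01 : v0 ≠ v1 := by simp [hv0, hv1]
  set T : Finset V := univ.filter fun v => 2 ≤ (e v : ℕ) ∧ (e v : ℕ) ≤ k with hT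
  have hTcard : T.card = k - 1 := by
    have : T.card = (Icc 2 k).card := by
      refine card_bij (fun v _ => (e v : ℕ)) (fun v hv => ?_) (fun u _ v _ h => ?_) fun i hi => ?_
      · simpa [hT] using hv
      · exact e.injective (Fin.ext h)
      · rw [mem_Icc] at hi
        exact ⟨e.symm ⟨i, by omega⟩, by simp [hT, hi], by simp⟩
    rw [this, Nat.card_Icc]
    omega
  have hT0 : v0 ∉ T := by simp [hT, hv0]
  have hT1 : v1 ∉ T := by simp [hT, hv1]
  -- A star centered at `v0` with `v1` joined to the `k - 1` vertices of `T`, so that `v0` and `v1`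
  -- have all of `T` as common neighbors.
  let G : SimpleGraph V := SimpleGraph.fromRel fun u v => u = v0 ∨ (u = v1 ∧ v ∈ T)
  have h0 : ∀ v, v ≠ v0 → G.Adj v0 v := fun v hv => ⟨hv.symm, by simp⟩
  have hconn : G.Connected := by
    have hr : ∀ v, G.Reachable v0 v := fun v => by
      by_cases hv : v = v0
      · rw [hv]
      · exact (h0 v hv).reachable
    exact ⟨fun u v => (hr u).symm.trans (hr v)⟩
  have hm : G.edgeSet.ncard ≤ (n - 1) + (k - 1) := by
    have hsub : G.edgeSet ⊆ ((univ.erase v0).image (fun v => s(v0, v)) ∪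
        T.image (fun v => s(v1, v)) : Finset (Sym2 V)) := by
      intro z
      induction z with
      | _ a b =>
      rintro ⟨hab, h⟩
      simp only [coe_union, coe_image, Set.mem_union, Set.mem_image, mem_coe, mem_erase,
        mem_univ, and_true]
      rcases h with (rfl | ⟨rfl, h⟩) | (rfl | ⟨rfl, h⟩)
      · exact Or.inl ⟨b, hab.symm, rfl⟩
      · exact Or.inr ⟨b, h, rfl⟩
      · exact Or.inl ⟨a, hab, Sym2.eq_swap⟩
      · exact Or.inr ⟨a, h, Sym2.eq_swap⟩
    refine (Set.ncard_le_ncard hsub (finite_toSet _)).trans ?_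
    rw [Set.ncard_coe_finset]
    refine (card_union_le _ _).trans (add_le_add (card_image_le.trans ?_)
      (card_image_le.trans hTcard.le))
    rw [card_erase_of_mem (mem_univ _), card_univ]
  have hle : rvd G ≤ k := rvd_le hk hconn (by omega)
  have hge : k ≤ rvd G := by
    have := card_add_one_le_rvd (G := G) (T := T) (h0 v1 h01.symm) fun z hz =>
      ⟨h0 z (fun h => hT0 (h ▸ hz)), ⟨fun h => hT1 (h ▸ hz), by simp [hz]⟩⟩
    omega
  refine ⟨G, hconn, le_antisymm hle hge, ?_⟩
  -- Fewer edges would make `rvd_le` give a value below `k`. For `k = 1` this would ask for zero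
  -- colors, so the edge bound for connected graphs is used.
  by_contra hne
  have h2 : 1 < k := by
    by_contra! h
    have h1 := le_degSum (connOn_univ hconn)
    rw [degSum_univ, card_univ] at h1
    omega
  have := rvd_le (k := k - 1) (by omega) hconn (by omega)
  omega

/-- A graph with `rvd` equal to the order that has the least number of edges. -/
theorem exists_rvd_eq_card [Fintype V] (hn : 4 ≤ Fintype.card V) : ∃ G : SimpleGraph V,
    G.Connected ∧ rvd G = Fintype.card V ∧
      G.edgeSet.ncard + 4 ≤ 2 * Fintype.card V + (Fintype.card V + 1) / 2 := by
  have hnt : Nontrivial V := Fintype.one_lt_card_iff_nontrivial.1 (by omega)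
  set n := Fintype.card V with hn'
  have e : V ≃ Fin n := Fintype.equivFin V
  set v0 := e.symm ⟨0, by omega⟩ with hv0
  set v1 := e.symm ⟨1, by omega⟩ with hv1
  have h01 : v0 ≠ v1 := by simp [hv0, hv1]
  set T : Finset V := univ.filter fun v => 2 ≤ (e v : ℕ) with hT
  have hTcard : T.card ≤ n - 2 := by
    have : T.card ≤ (Ico 2 n).card := card_le_card_of_injOn (fun v => (e v : ℕ))
      (fun v hv => by simpa [hT] using hv) (fun u _ v _ h => e.injective (Fin.ext h))
    simpa using this
  set E : Finset V := univ.filter fun v => 2 ≤ (e v : ℕ) ∧ (e v : ℕ) % 2 = 0 with hE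
  have hEcard : E.card ≤ (n - 1) / 2 := by
    have : E.card ≤ (Icc 1 ((n - 1) / 2)).card := by
      refine card_le_card_of_injOn (fun v => (e v : ℕ) / 2) (fun v hv => ?_) fun u hu v hv h => ?_
      · have := (e v).2
        simp only [hE, coe_filter, mem_univ, true_and, Set.mem_ofPred_eq] at hv
        simp only [coe_Icc, Set.mem_Icc]
        omega
      · simp only [hE, coe_filter, mem_univ, true_and, Set.mem_ofPred_eq] at hu hv
        refine e.injective (Fin.ext ?_)
        dsimp only at h
        omega
    simpa using this
  -- Only even indices from 2 on are used: each is matched with its successor. For odd `n` the last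
  -- vertex is attached to its predecessor, which already has a partner.
  let m : V → V := fun v => if h : (e v : ℕ) + 1 < n then e.symm ⟨(e v : ℕ) + 1, h⟩
    else e.symm ⟨(e v : ℕ) - 1, by omega⟩
  let G : SimpleGraph V := SimpleGraph.fromRel fun u v => u = v0 ∨ u = v1 ∨ (u ∈ E ∧ v = m u)
  have h0 : ∀ v, v ≠ v0 → G.Adj v0 v := fun v hv => ⟨hv.symm, by simp⟩
  have h1 : ∀ v, v ≠ v1 → G.Adj v1 v := fun v hv => ⟨hv.symm, by simp⟩
  have hconn : G.Connected := by
    have hr : ∀ v, G.Reachable v0 v := fun v => by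
      by_cases hv : v = v0
      · rw [hv]
      · exact (h0 v hv).reachable
    exact ⟨fun u v => (hr u).symm.trans (hr v)⟩
  have hlt : ∀ v, v ≠ v0 → v ≠ v1 → 2 ≤ (e v : ℕ) := by
    intro v hv0' hv1'
    by_contra! h
    have hc : (e v : ℕ) = 0 ∨ (e v : ℕ) = 1 := by omega
    rcases hc with h | h
    · exact hv0' (by rw [hv0, Equiv.eq_symm_apply]; exact Fin.ext h)
    · exact hv1' (by rw [hv1, Equiv.eq_symm_apply]; exact Fin.ext h)
  have hm : G.edgeSet.ncard ≤ (n - 1) + (n - 2) + (n - 1) / 2 := by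
    have hsub : G.edgeSet ⊆ ((univ.erase v0).image (fun v => s(v0, v)) ∪
        T.image (fun v => s(v1, v)) ∪ E.image (fun v => s(v, m v)) : Finset (Sym2 V)) := by
      intro z
      induction z with
      | _ a b =>
      have key : ∀ a b, a ≠ b → (a = v0 ∨ a = v1 ∨ (a ∈ E ∧ b = m a)) →
          s(a, b) ∈ ((univ.erase v0).image (fun v => s(v0, v)) ∪
          T.image (fun v => s(v1, v)) ∪ E.image (fun v => s(v, m v)) : Finset (Sym2 V)) := by
        intro a b hab h
        simp only [mem_union, mem_image, mem_erase, mem_univ, and_true]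
        rcases h with h | h | ⟨h, h'⟩
        · exact Or.inl (Or.inl ⟨b, by rw [← h]; exact hab.symm, by rw [h]⟩)
        · by_cases hb : b = v0
          · exact Or.inl (Or.inl ⟨a, by rw [h]; exact h01.symm, by rw [hb]; exact Sym2.eq_swap⟩)
          · refine Or.inl (Or.inr ⟨b, ?_, by rw [h]⟩)
            simpa [hT] using hlt b hb (by rw [← h]; exact hab.symm)
        · exact Or.inr ⟨a, h, by rw [h']⟩
      rintro ⟨hab, h | h⟩
      · exact key a b hab h
      · rw [Sym2.eq_swap]
        exact key b a hab.symm h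
    refine (Set.ncard_le_ncard hsub (finite_toSet _)).trans ?_
    rw [Set.ncard_coe_finset]
    refine (card_union_le _ _).trans (add_le_add ((card_union_le _ _).trans (add_le_add
      (card_image_le.trans ?_) (card_image_le.trans hTcard))) (card_image_le.trans hEcard))
    rw [card_erase_of_mem (mem_univ _), card_univ]
  -- every other vertex has a neighbor besides the two hubs
  have hmate : ∀ v, v ≠ v0 → v ≠ v1 → ∃ u, u ≠ v0 ∧ u ≠ v1 ∧ G.Adj v u := by
    intro v hv0' hv1'
    have hv2 := hlt v hv0' hv1'
    have hvn := (e v).2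
    have hne : ∀ (i : ℕ) (hi : i < n), 2 ≤ i → e.symm ⟨i, hi⟩ ≠ v0 ∧ e.symm ⟨i, hi⟩ ≠ v1 := by
      intro i hi h2
      rw [hv0, hv1]
      simp only [ne_eq, EmbeddingLike.apply_eq_iff_eq, Fin.mk.injEq]
      omega
    have hvne : ∀ (i : ℕ) (hi : i < n), i ≠ (e v : ℕ) → v ≠ e.symm ⟨i, hi⟩ := by
      rintro i hi h rfl
      simp at h
    by_cases hpar : (e v : ℕ) % 2 = 0
    · have hvE : v ∈ E := by simp [hE, hv2, hpar]
      by_cases hlast : (e v : ℕ) + 1 < n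
      · have hmv : m v = e.symm ⟨(e v : ℕ) + 1, hlast⟩ := dif_pos hlast
        refine ⟨m v, ?_, ?_, ?_, Or.inl (Or.inr (Or.inr ⟨hvE, rfl⟩))⟩
        · rw [hmv]; exact (hne _ _ (by omega)).1
        · rw [hmv]; exact (hne _ _ (by omega)).2
        · rw [hmv]; exact hvne _ _ (by omega)
      · have hmv : m v = e.symm ⟨(e v : ℕ) - 1, by omega⟩ := dif_neg hlast
        refine ⟨m v, ?_, ?_, ?_, Or.inl (Or.inr (Or.inr ⟨hvE, rfl⟩))⟩
        · rw [hmv]; exact (hne _ _ (by omega)).1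
        · rw [hmv]; exact (hne _ _ (by omega)).2
        · rw [hmv]; exact hvne _ _ (by omega)
    · set u : V := e.symm ⟨(e v : ℕ) - 1, by omega⟩ with hu
      have heu : (e u : ℕ) = (e v : ℕ) - 1 := by simp [hu]
      have hmu : m u = v := by
        have h : (e u : ℕ) + 1 < n := by omega
        have : m u = e.symm ⟨(e u : ℕ) + 1, h⟩ := dif_pos h
        rw [this, Equiv.symm_apply_eq]
        exact Fin.ext (by simp only; omega)
      refine ⟨u, (hne _ _ (by omega)).1, (hne _ _ (by omega)).2, hvne _ _ (by omega),
        Or.inr (Or.inr (Or.inr ⟨?_, hmu.symm⟩))⟩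
      simp only [hE, mem_filter, mem_univ, true_and, heu]
      omega
  refine ⟨G, hconn, le_antisymm rvd_le_card (card_le_rvd ?_), by omega⟩
  have hub : ∀ v, v ≠ v0 → v ≠ v1 → G.Adj v v0 ∧ G.Adj v v1 := fun v h h' =>
    ⟨(h0 v h).symm, (h1 v h').symm⟩
  -- Two hubs share `a` and `b`, a hub and an ordinary vertex share the other hub and a mate of that
  -- vertex, and two ordinary vertices share both hubs.
  obtain ⟨a, ha0, ha1⟩ : ∃ a, a ≠ v0 ∧ a ≠ v1 :=
    ⟨e.symm ⟨2, by omega⟩, by simp [hv0], by simp [hv1]⟩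
  obtain ⟨b, hb0, hb1, hab⟩ := hmate a ha0 ha1
  intro x y hxy
  by_cases hx0 : x = v0
  · by_cases hy1 : y = v1
    · rw [hx0, hy1]
      exact ⟨a, b, hab.ne, h0 a ha0, h0 b hb0, h1 a ha1, h1 b hb1⟩
    · have hy0 : y ≠ v0 := fun h => hxy (hx0.trans h.symm)
      obtain ⟨u, hu0, hu1, hyu⟩ := hmate y hy0 hy1
      rw [hx0]
      exact ⟨v1, u, hu1.symm, h0 _ h01.symm, h0 u hu0, (hub y hy0 hy1).2, hyu⟩
  by_cases hx1 : x = v1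
  · by_cases hy0 : y = v0
    · rw [hx1, hy0]
      exact ⟨a, b, hab.ne, h1 a ha1, h1 b hb1, h0 a ha0, h0 b hb0⟩
    · have hy1 : y ≠ v1 := fun h => hxy (hx1.trans h.symm)
      obtain ⟨u, hu0, hu1, hyu⟩ := hmate y hy0 hy1
      rw [hx1]
      exact ⟨v0, u, hu0.symm, h1 _ h01, h1 u hu1, (hub y hy0 hy1).1, hyu⟩
  obtain ⟨u, hu0, hu1, hxu⟩ := hmate x hx0 hx1
  by_cases hy0 : y = v0
  · rw [hy0]
    exact ⟨v1, u, hu1.symm, (hub x hx0 hx1).2, hxu, h0 _ h01.symm, h0 u hu0⟩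
  by_cases hy1 : y = v1
  · rw [hy1]
    exact ⟨v0, u, hu0.symm, (hub x hx0 hx1).1, hxu, h1 _ h01, h1 u hu1⟩
  exact ⟨v0, v1, h01, (hub x hx0 hx1).1, (hub x hx0 hx1).2, (hub y hy0 hy1).1, (hub y hy0 hy1).2⟩

end Extremal

theorem ceil_div_two (n : ℕ) : ⌈(n : ℚ) / 2⌉₊ = (n + 1) / 2 := by
  apply le_antisymm
  · rw [Nat.ceil_le, div_le_iff₀ (by norm_num)]
    exact_mod_cast (by omega : n ≤ (n + 1) / 2 * 2)
  · rw [← Nat.lt_add_one_iff, Nat.div_lt_iff_lt_mul (by norm_num)]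
    have h := Nat.le_ceil ((n : ℚ) / 2)
    rw [div_le_iff₀ (by norm_num)] at h
    have : n ≤ ⌈(n : ℚ) / 2⌉₊ * 2 := by exact_mod_cast h
    omega

end RainbowVertexDisconnection

theorem mainTheorem4 (n k : ℕ) (hn : 4 ≤ n) (hk : 1 ≤ k) (hkn : k ≤ n)
    (V : Type*) [Finite V] (hV : Nat.card V = n) :
    IsLeast
      {m : ℕ | ∃ G : SimpleGraph V,
        G.Connected ∧ RainbowVertexDisconnection.rvd G = k ∧ G.edgeSet.ncard = m}
      (if k ≤ n - 1 then n + k - 2 else 2 * n - 4 + ⌈(n : ℚ) / 2⌉₊) := by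
  open RainbowVertexDisconnection in
  have := Fintype.ofFinite V
  rw [Nat.card_eq_fintype_card] at hV
  subst hV
  have hnt : Nontrivial V := Fintype.one_lt_card_iff_nontrivial.1 (by omega)
  rw [ceil_div_two]
  have low : ∀ G : SimpleGraph V, rvd G = Fintype.card V →
      5 * Fintype.card V ≤ 2 * G.edgeSet.ncard + 8 := fun G hG => by
    refine le_ncard_edgeSet hn fun x y hxy => ?_
    by_contra! h
    exact (rvd_lt_card hxy (Nat.le_of_lt_succ h)).ne hG
  split_ifs with hkn1
  · constructor
    · obtain ⟨G, hG, hr, hm⟩ := exists_rvd_eq (V := V) hn hk (by omega)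
      exact ⟨G, hG, hr, by omega⟩
    · rintro m ⟨G, hG, hr, rfl⟩
      by_contra! hlt
      by_cases h1 : k = 1
      · have h := le_degSum (connOn_univ hG)
        rw [degSum_univ, Finset.card_univ] at h
        omega
      -- With fewer than `n + k - 2` edges, `k - 1` colors would suffice.
      · have := rvd_le (k := k - 1) (by omega) hG (by omega)
        omega
  · obtain rfl : k = Fintype.card V := by omega
    constructor
    · obtain ⟨G, hG, hr, hm⟩ := exists_rvd_eq_card (V := V) hn
      have := low G hr
      exact ⟨G, hG, hr, by omega⟩
    · rintro m ⟨G, hG, hr, rfl⟩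
      have := low G hr
      omega
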